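/- Let $\mathbb{F}$ be an algebraically closed field, let $d\ge 1$ be an integer, and let $\mathrm{PG}(d,\mathbb{F})$ be the $d$-dimensional projective space over $\mathbb{F}$, whose points are the one-dimensional subspaces of $\mathbb{F}^{d+1}$. A set $\mathcal{G}$ of points of $\mathrm{PG}(d,\mathbb{F})$ is called a generator set (with respect to hyperplanes) if every hyperplane $\Pi$ is spanned by $\mathcal{G}\cap\Pi$; a set $\mathcal{L}$ of lines is called a generator set if the set $\bigcup\mathcal{L}$ of all points on its lines is a generator set. Theorem. If a set $\mathcal{L}$ of lines in $\mathrm{PG}(d,\mathbb{F})$ has at most $2d-2$ elements, then there exists a projective subspace $H$ of $\mathrm{PG}(d,\mathbb{F})$ of co-dimension two that meets each element of $\mathcal{L}$ (that is, has a point in common with it), and $\mathcal{L}$ is not a generator set. (For $d=1$, the subspace of co-dimension two is the empty one and $\mathcal{L}=\emptyset$.) -/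

import Mathlib

open scoped LinearAlgebra.Projectivization

/-- The points of the projective space `PG(d, F)`. -/
abbrev PG (d : ℕ) (F : Type*) [Field F] : Type _ := ℙ F (Fin (d + 1) → F)

/-- The projective subspaces of `PG(d, F)` (including the empty one and the whole space). -/
abbrev PGSubspace (d : ℕ) (F : Type*) [Field F] : Type _ :=
  Projectivization.Subspace F (Fin (d + 1) → F)

namespace PGSubspace

variable {d : ℕ} {F : Type*} [Field F]

/-- `S` has projective dimension `k`: its underlying vector space has dimension `k + 1`. -/
def HasDim (S : PGSubspace d F) (k : ℕ) : Prop :=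
  Module.finrank F (Projectivization.Subspace.submodule S) = k + 1

/-- `S` has co-dimension `k` in `PG(d, F)`, that is, projective dimension `d - k`
(the empty subspace has dimension `-1`, hence co-dimension `d + 1`). -/
def HasCodim (S : PGSubspace d F) (k : ℕ) : Prop :=
  Module.finrank F (Projectivization.Subspace.submodule S) + k = d + 1

/-- A line is a subspace of projective dimension one. -/
def IsLine (S : PGSubspace d F) : Prop := S.HasDim 1

/-- A hyperplane is a subspace of co-dimension one. -/
def IsHyperplane (S : PGSubspace d F) : Prop := S.HasCodim 1

/-- Two subspaces meet if they have a common point. -/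
def Meets (S T : PGSubspace d F) : Prop := ∃ P : PG d F, P ∈ S ∧ P ∈ T

end PGSubspace

/-- A set `G` of points of `PG(d, F)` is a generator set with respect to hyperplanes if
every hyperplane is spanned by its points in `G`. -/
def IsGeneratorSet {d : ℕ} {F : Type*} [Field F] (G : Set (PG d F)) : Prop :=
  ∀ P : PGSubspace d F, P.IsHyperplane →
    Projectivization.Subspace.span (G ∩ (P : Set (PG d F))) = P

/-- A set `L` of lines is a generator set with respect to hyperplanes if the set of all
points on the lines of `L` is one. -/
def IsLineGeneratorSet {d : ℕ} {F : Type*} [Field F] (L : Set (PGSubspace d F)) : Prop :=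
  IsGeneratorSet (⋃ l ∈ L, (l : Set (PG d F)))

/-! Codimension-two subspaces `ker f ∩ ker g` form a Grassmannian of dimension `2(d - 1)`, and
meeting a given line is one linear condition on the Plücker coordinates of `f ∧ g`. Hence `2d - 2`
such conditions have a common solution `H`: this is `exists_ne_zero_common_zero`, proved by
Nullstellensatz and integrality, applied to the cone over the Grassmannian. A hyperplane through `H`
that is spanned by its points on `L` contains a line of `L` not inside `H`. Such a line lies in only
one hyperplane through `H`, but the pencil through `H` is infinite. -/

namespace MvPolynomial

/-- Homogeneous equations, the first family vanishing at a `B`-valued generic point and the second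
consisting of fewer linear forms than the transcendence degree, have a nontrivial common zero. -/
theorem exists_ne_zero_common_zero {σ F B κ : Type*} [Finite σ] [Field F] [IsAlgClosed F]
    [CommRing B] [IsDomain B] [Algebra F B] (z : σ → B)
    (hz : Algebra.IsAlgebraic (Algebra.adjoin F (Set.range z)) B)
    (Q : Set (MvPolynomial σ F)) (hQ : ∀ q ∈ Q, (∃ d, q.IsHomogeneous d) ∧ aeval z q = 0)
    [Finite κ] (l : κ → MvPolynomial σ F) (hl : ∀ k, (l k).IsHomogeneous 1)
    (hcard : (Nat.card κ : Cardinal) < Algebra.trdeg F B) :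
    ∃ P : σ → F, P ≠ 0 ∧ (∀ q ∈ Q, eval P q = 0) ∧ ∀ k, eval P (l k) = 0 := by
  by_contra! hno
  set s : Set B := Set.range fun k => aeval z (l k) with hs
  set A := Algebra.adjoin F s with hA
  set J : Ideal (MvPolynomial σ F) := Ideal.span (Q ∪ Set.range l) with hJ
  -- Nullstellensatz: `J` has no zero other than the origin.
  have hrad : idealOfVars σ F ≤ J.radical := by
    rw [← vanishingIdeal_zeroLocus_eq_radical (K := F) J, idealOfVars, Ideal.span_le]
    rintro _ ⟨i, rfl⟩ P hP
    have h0 : P = 0 := by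
      by_contra hP0
      obtain ⟨k, hk⟩ := hno P hP0 fun q hq => by
        simpa [aeval_eq_eval] using hP q (Ideal.subset_span (Or.inl hq))
      exact hk (by simpa [aeval_eq_eval] using hP (l k) (Ideal.subset_span (Or.inr ⟨k, rfl⟩)))
    simp [h0]
  obtain ⟨D, hD⟩ := J.exists_radical_pow_le_of_fg J.radical.fg_of_isNoetherianRing
  have hDJ : idealOfVars σ F ^ D ≤ J := (Ideal.pow_right_mono hrad D).trans hD
  set G : Set B := (fun m : σ →₀ ℕ => aeval z (monomial m (1 : F))) '' {m | m.degree ≤ D} with hG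
  -- This finitely generated `A`-module will turn out to contain all of `F[z]`, which makes each `z
  -- i` integral over `A`.
  set M : Submodule A B := Submodule.span A G with hM
  have hGfin : G.Finite := (Finsupp.finite_of_degree_le D).image _
  have hsM : ∀ a ∈ s, ∀ b ∈ M, a * b ∈ M := fun a ha b hb =>
    M.smul_mem (⟨a, Algebra.subset_adjoin ha⟩ : A) hb
  have hFM : ∀ (c : F), ∀ b ∈ M, c • b ∈ M := fun c b hb => by
    have := M.smul_mem (algebraMap F A c) hb
    rwa [algebraMap_smul] at this
  have key : ∀ k, ∀ p : MvPolynomial σ F, p.IsHomogeneous k → aeval z p ∈ M := by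
    intro k
    induction k using Nat.strong_induction_on with
    | _ k ih =>
    intro p hp
    by_cases hk : k ≤ D
    · rw [p.as_sum, map_sum]
      refine M.sum_mem fun m hm => ?_
      have hmk : m.degree = k := by
        rw [Finsupp.degree_eq_weight_one]; exact hp (mem_support_iff.1 hm)
      rw [← mul_one (coeff m p), ← smul_eq_mul, ← smul_monomial, map_smul]
      exact hFM _ _ (Submodule.subset_span ⟨m, by simpa [hmk] using hk, rfl⟩)
    · have hpJ : p ∈ J := hDJ <| by
        rw [mem_pow_idealOfVars_iff]
        intro m hm
        have hmk : m.degree = k := by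
          rw [Finsupp.degree_eq_weight_one]; exact hp (mem_support_iff.1 hm)
        omega
      -- In degree `k`, multiples of elements of `Q` vanish at `z`; multiples of `l j` have a
      -- cofactor of degree `k - 1`, covered by induction.
      rw [← homogeneousComponent_eq_self hp]
      clear hp
      induction hpJ using Submodule.closure_induction with
      | zero => simp
      | add x y _ _ hx hy => simpa using M.add_mem hx hy
      | smul_mem c g hg =>
        obtain ⟨e, he⟩ : ∃ e, g.IsHomogeneous e := by
          rcases hg with hg | ⟨i, rfl⟩
          exacts [(hQ g hg).1, ⟨1, hl i⟩]
        rw [smul_eq_mul, ← sum_homogeneousComponent c, Finset.sum_mul, map_sum, map_sum]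
        refine M.sum_mem fun i _ => ?_
        rw [homogeneousComponent_of_mem
          ((homogeneousComponent_isHomogeneous i c).mul he : _ ∈ homogeneousSubmodule σ F (i + e))]
        split_ifs with hik
        · rw [map_mul]
          rcases hg with hg | ⟨j, rfl⟩
          · simp [(hQ g hg).2]
          · rw [mul_comm]
            by_cases hz0 : l j = 0
            · simp [hz0]
            have := (hl j).inj_right he hz0
            exact hsM _ ⟨j, rfl⟩ _ (ih i (by omega) _ (homogeneousComponent_isHomogeneous i c))
        · simp
  have hM1 : (1 : B) ∈ M := by simpa using key 0 1 (isHomogeneous_one σ F)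
  have hint : ∀ i, IsIntegral A (z i) := fun i => by
    refine isIntegral_of_smul_mem_submodule M (fun h => one_ne_zero ((Submodule.mem_bot A).1 (h ▸ hM1)))
      ⟨hGfin.toFinset, by simp [hM]⟩ (z i) fun n hn => ?_
    induction hn using Submodule.span_induction with
    | mem x hx =>
      obtain ⟨m, -, rfl⟩ := hx
      have := key _ _ ((isHomogeneous_X F i).mul (isHomogeneous_monomial (1 : F) (d := m) rfl))
      simpa using this
    | zero => simp
    | add x y _ _ hx hy => simpa [mul_add] using M.add_mem hx hy
    | smul a x _ hx => rw [smul_comm]; exact M.smul_mem a hx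
  have hspan : (AlgebraicIndependent.matroid F B).Spanning s := by
    have h1 := (AlgebraicIndependent.matroid_spanning_iff (R := F)).2 hz
    have h2 : Set.range z ⊆ (AlgebraicIndependent.matroid F B).closure s := by
      rintro _ ⟨i, rfl⟩
      rw [AlgebraicIndependent.matroid_closure_eq]
      exact (hint i).isAlgebraic
    rw [Matroid.spanning_iff_closure_eq] at h1 ⊢
    refine le_antisymm (Matroid.closure_subset_ground _ _) ?_
    rw [← h1]
    exact (Matroid.closure_subset_closure _ h2).trans (Matroid.closure_closure _ _).le
  have := AlgebraicIndependent.matroid_spanning_iff.1 hspan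
  refine (hcard.trans_le (Algebra.IsAlgebraic.trdeg_le_cardinalMk F s)).not_ge ?_
  have hsfin : Finite s := Set.finite_range _
  rw [← Nat.cast_card, Nat.cast_le]
  exact Finite.card_range_le _

end MvPolynomial

/-! ### Plücker coordinates and the Grassmannian -/

section

open MvPolynomial Module

/-- At most `2k` bilinear conditions `f(a)g(b) = f(b)g(a)` are satisfied by a pair of linearly
independent functionals on a space of dimension `k + 2`. -/
theorem exists_linearIndependent_det_eq_zero {F : Type*} [Field F] [IsAlgClosed F] (k : ℕ)
    {κ : Type*} [Finite κ] (hκ : Nat.card κ ≤ 2 * k) (a b : κ → Fin (k + 2) → F) :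
    ∃ f g : Dual F (Fin (k + 2) → F), LinearIndependent F ![f, g] ∧
      ∀ i, f (a i) * g (b i) = f (b i) * g (a i) := by
  -- The minors of the generic matrix with rows `(1, 0, *)` and `(0, t, *)`, where `t = X none`,
  -- parametrize the affine cone; its dimension is `2k + 1`, one more than the number of conditions
  -- allowed.
  let τ := Option (Fin k ⊕ Fin k)
  let x : Fin (k + 2) → MvPolynomial τ F := Fin.cons 1 (Fin.cons 0 fun j => X (some (.inl j)))
  let y : Fin (k + 2) → MvPolynomial τ F :=
    Fin.cons 0 (Fin.cons (X none) fun j => X (some (.inr j)))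
  let z : Fin (k + 2) × Fin (k + 2) → MvPolynomial τ F := fun p => x p.1 * y p.2 - x p.2 * y p.1
  have hz : Algebra.IsAlgebraic (Algebra.adjoin F (Set.range z)) (MvPolynomial τ F) := by
    have hmem : ∀ p, IsAlgebraic (Algebra.adjoin F (Set.range z)) (z p) := fun p =>
      isAlgebraic_algebraMap
        (⟨z p, Algebra.subset_adjoin ⟨p, rfl⟩⟩ : Algebra.adjoin F (Set.range z))
    have h0 : IsAlgebraic (Algebra.adjoin F (Set.range z)) (X none : MvPolynomial τ F) := by
      simpa [z, x, y] using hmem (0, 1)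
    have hr : ∀ j : Fin k, IsAlgebraic (Algebra.adjoin F (Set.range z))
        (X (some (.inr j)) : MvPolynomial τ F) := fun j => by
      simpa [z, x, y] using hmem (0, j.succ.succ)
    have hl : ∀ j : Fin k, IsAlgebraic (Algebra.adjoin F (Set.range z))
        (X (some (.inl j)) : MvPolynomial τ F) := fun j => by
      refine IsAlgebraic.of_mul (mem_nonZeroDivisors_of_ne_zero (X_ne_zero none)) h0 ?_
      have := hmem (j.succ.succ, 1)
      simpa [z, x, y, mul_comm] using this
    refine ⟨fun p => ?_⟩
    induction p using MvPolynomial.induction_on with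
    | C c => exact isAlgebraic_algebraMap (algebraMap F (Algebra.adjoin F (Set.range z)) c)
    | add p q hp hq => exact hp.add hq
    | mul_X p i hp =>
      refine hp.mul ?_
      rcases i with _ | i | i
      exacts [h0, hl i, hr i]
  let Q : Set (MvPolynomial (Fin (k + 2) × Fin (k + 2)) F) :=
    (Set.range fun i => X (i, i)) ∪ (Set.range fun p : Fin (k + 2) × Fin (k + 2) =>
      X (p.1, p.2) + X (p.2, p.1)) ∪
    (Set.range fun p : (Fin (k + 2) × Fin (k + 2)) × (Fin (k + 2) × Fin (k + 2)) =>
      X (p.1.1, p.1.2) * X (p.2.1, p.2.2) - X (p.1.1, p.2.1) * X (p.1.2, p.2.2) +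
        X (p.1.1, p.2.2) * X (p.1.2, p.2.1))
  have hX := fun p => isHomogeneous_X (σ := Fin (k + 2) × Fin (k + 2)) F p
  obtain ⟨P, hP0, hPQ, hPl⟩ := exists_ne_zero_common_zero z hz Q
    (by
      rintro _ ((⟨i, rfl⟩ | ⟨p, rfl⟩) | ⟨p, rfl⟩)
      · exact ⟨⟨1, hX _⟩, by simp [z, mul_comm]⟩
      · exact ⟨⟨1, (hX _).add (hX _)⟩, by simp [z]⟩
      · refine ⟨⟨2, (((hX _).mul (hX _)).sub ((hX _).mul (hX _))).add ((hX _).mul (hX _))⟩, ?_⟩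
        simp only [map_add, map_sub, map_mul, aeval_X, z]
        ring)
    (fun i => ∑ p : Fin (k + 2) × Fin (k + 2), C (a i p.1 * b i p.2) * X p)
    (fun i => IsHomogeneous.sum _ _ _ fun p _ => (isHomogeneous_C_mul_X _ p))
    (by
      rw [MvPolynomial.trdeg_of_isDomain]
      simp only [τ, Cardinal.mk_fintype, Fintype.card_option, Fintype.card_sum, Fintype.card_fin,
        Cardinal.lift_natCast, Nat.cast_lt]
      omega)
  have hskew : ∀ i j, P (i, j) + P (j, i) = 0 := fun i j => by
    simpa using hPQ _ (Or.inl (Or.inr ⟨(i, j), rfl⟩))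
  have hdiag : ∀ i, P (i, i) = 0 := fun i => by
    simpa using hPQ _ (Or.inl (Or.inl ⟨i, rfl⟩))
  have hpl : ∀ i j m n, P (i, j) * P (m, n) - P (i, m) * P (j, n) + P (i, n) * P (j, m) = 0 :=
    fun i j m n => by simpa using hPQ _ (Or.inr ⟨((i, j), (m, n)), rfl⟩)
  obtain ⟨⟨i₀, j₀⟩, h0⟩ := Function.ne_iff.1 hP0
  simp only [Pi.zero_apply] at h0
  let f : Dual F (Fin (k + 2) → F) := Fintype.linearCombination F fun j => P (i₀, j)
  let g : Dual F (Fin (k + 2) → F) := Fintype.linearCombination F fun j => P (j₀, j)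
  have hf : ∀ v, f v = ∑ j, v j * P (i₀, j) := fun v => by
    simp [f, Fintype.linearCombination_apply]
  have hg : ∀ v, g v = ∑ j, v j * P (j₀, j) := fun v => by
    simp [g, Fintype.linearCombination_apply]
  -- The Plücker relations make `P` decomposable: two of its rows wedge to a nonzero multiple of
  -- `P`.
  have hfg : ∀ v w, f v * g w - f w * g v = P (i₀, j₀) * ∑ p : _ × _, v p.1 * w p.2 * P p := by
    intro v w
    rw [hf, hg, hf, hg, mul_comm (∑ j, w j * P (i₀, j)), Finset.sum_mul_sum, Finset.sum_mul_sum,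
      Fintype.sum_prod_type, Finset.mul_sum, ← Finset.sum_sub_distrib]
    refine Finset.sum_congr rfl fun m _ => ?_
    rw [Finset.mul_sum, ← Finset.sum_sub_distrib]
    refine Finset.sum_congr rfl fun n _ => ?_
    linear_combination (-(v m * w n)) * hpl i₀ j₀ m n
  refine ⟨f, g, LinearIndependent.pair_iff.2 fun α β h => ?_, fun i => ?_⟩
  · have h1 := LinearMap.congr_fun h (Pi.single i₀ 1)
    have h2 := LinearMap.congr_fun h (Pi.single j₀ 1)
    simp only [LinearMap.add_apply, LinearMap.smul_apply, hf, hg, Pi.single_apply, ite_mul,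
      one_mul, zero_mul, Finset.sum_ite_eq', Finset.mem_univ, if_true, hdiag, smul_eq_mul,
      mul_zero, zero_add, add_zero, LinearMap.zero_apply] at h1 h2
    refine ⟨(mul_eq_zero.1 h2).resolve_right h0, (mul_eq_zero.1 h1).resolve_right fun h3 => h0 ?_⟩
    simpa [h3] using hskew i₀ j₀
  · have := hPl i
    simp only [map_sum, map_mul, eval_C, eval_X] at this
    rw [← sub_eq_zero, hfg, this, mul_zero]

end

/-! ### Lines and the pencil of hyperplanes through `H` -/

namespace PGSubspace

open Module

variable {d : ℕ} {F : Type*} [Field F]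

/-- A line on which two functionals `f`, `g` are linearly dependent meets `ker f ∩ ker g`. -/
theorem exists_mem_ne_zero_of_det_eq_zero {V : Type*} [AddCommGroup V] [Module F V]
    {f g : Dual F V} {a b : V} (hab : LinearIndependent F ![a, b])
    (h : f a * g b = f b * g a) :
    ∃ v ∈ Submodule.span F {a, b}, v ≠ 0 ∧ f v = 0 ∧ g v = 0 := by
  obtain ⟨w, hw, hw0⟩ := (Matrix.exists_mulVec_eq_zero_iff (M := !![f a, f b; g a, g b])).2
    (by rw [Matrix.det_fin_two_of, h, sub_self])
  refine ⟨w 0 • a + w 1 • b, Submodule.mem_span_pair.2 ⟨_, _, rfl⟩, fun h0 => hw ?_, ?_, ?_⟩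
  · have := LinearIndependent.pair_iff.1 hab _ _ h0
    ext i; fin_cases i <;> simp [this]
  · have := congr_fun hw0 0
    simpa [Matrix.mulVec, dotProduct, mul_comm] using this
  · have := congr_fun hw0 1
    simpa [Matrix.mulVec, dotProduct, mul_comm] using this

/-- The common kernel of two functionals, as a projective subspace. -/
noncomputable def commonKer (f g : Dual F (Fin (d + 1) → F)) : PGSubspace d F :=
  Submodule.projectivization (Submodule.span F {f, g}).dualCoannihilator

theorem mk_mem_commonKer {f g : Dual F (Fin (d + 1) → F)} {v : Fin (d + 1) → F} (hv : v ≠ 0) :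
    Projectivization.mk F v hv ∈ commonKer f g ↔ f v = 0 ∧ g v = 0 := by
  rw [commonKer, Submodule.mk_mem_projectivization_iff, Submodule.mem_dualCoannihilator]
  refine ⟨fun h => ⟨h f (Submodule.subset_span (by simp)), h g (Submodule.subset_span (by simp))⟩,
    fun h φ hφ => ?_⟩
  obtain ⟨a, b, rfl⟩ := Submodule.mem_span_pair.1 hφ
  simp [h.1, h.2]

theorem hasCodim_commonKer {f g : Dual F (Fin (d + 1) → F)} (h : LinearIndependent F ![f, g]) :
    (commonKer f g).HasCodim 2 := by
  have h1 := Subspace.finrank_add_finrank_dualCoannihilator_eq (Submodule.span F {f, g})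
  have h2 : finrank F (Submodule.span F {f, g}) = 2 := by
    rw [← Matrix.range_cons_cons_empty f g ![], finrank_span_eq_card h, Fintype.card_fin]
  rw [HasCodim, commonKer, OrderIso.apply_symm_apply]
  rw [finrank_fintype_fun_eq_card, Fintype.card_fin] at h1
  omega

theorem isHyperplane_ker {f : Dual F (Fin (d + 1) → F)} (h : f ≠ 0) :
    IsHyperplane (Submodule.projectivization (LinearMap.ker f)) := by
  have := Dual.finrank_ker_add_one_of_ne_zero h
  rw [finrank_fintype_fun_eq_card, Fintype.card_fin] at this
  rw [IsHyperplane, HasCodim, OrderIso.apply_symm_apply, this]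

/-- A line meeting a subspace `H` of a subspace `T`, but not contained in `T`, meets `T` only
in points of `H`. -/
theorem IsLine.mem_of_mem_of_not_le {l H T : PGSubspace d F} (hl : l.IsLine) (hHT : H ≤ T)
    (hm : H.Meets l) (hlT : ¬ l ≤ T) {P : PG d F} (hPl : P ∈ l) (hPT : P ∈ T) : P ∈ H := by
  obtain ⟨R, hRH, hRl⟩ := hm
  induction P using Projectivization.ind with | h p hp =>
  induction R using Projectivization.ind with | h r hr =>
  set l' := Projectivization.Subspace.submodule l
  set T' := Projectivization.Subspace.submodule T
  have hlt : finrank F ↥(l' ⊓ T') < finrank F l' := by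
    refine Submodule.finrank_lt_finrank_of_lt (lt_of_le_of_ne inf_le_left fun h => hlT ?_)
    exact Projectivization.Subspace.submodule.le_iff_le.1 (inf_eq_left.1 h)
  rw [show finrank F l' = 2 from hl] at hlt
  have hp' : p ∈ l' ⊓ T' := ⟨fun _ => hPl, fun _ => hPT⟩
  have hr' : r ∈ l' ⊓ T' := ⟨fun _ => hRl, fun _ => hHT hRH⟩
  -- So `l` and `T` share exactly one point, the point `R` of `H`.
  have h1 : finrank F ↥(l' ⊓ T') = 1 := by
    have : 0 < finrank F ↥(l' ⊓ T') :=
      finrank_pos_iff_exists_ne_zero.2 ⟨⟨r, hr'⟩, fun h => hr (congr_arg Subtype.val h)⟩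
    omega
  obtain ⟨c, hc⟩ := (finrank_eq_one_iff_of_nonzero' (⟨r, hr'⟩ : ↥(l' ⊓ T'))
    fun h => hr (congr_arg Subtype.val h)).1 h1 ⟨p, hp'⟩
  have hc' : c • r = p := congr_arg Subtype.val hc
  rwa [(Projectivization.mk_eq_mk_iff' F p r hp hr).2 ⟨c, hc'⟩]

/-- Finitely many lines all meeting a subspace of co-dimension two do not form a generator set. -/
theorem not_isLineGeneratorSet_of_meets [Infinite F] {L : Set (PGSubspace d F)} (hfin : L.Finite)
    (hL : ∀ l ∈ L, l.IsLine) {f g : Dual F (Fin (d + 1) → F)} (h : LinearIndependent F ![f, g])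
    (hmeet : ∀ l ∈ L, (commonKer f g).Meets l) : ¬ IsLineGeneratorSet L := by
  intro hgen
  have key : ∀ c : F, ∃ l ∈ L, l ≤ Submodule.projectivization (LinearMap.ker (f + c • g)) ∧
      ¬ l ≤ commonKer f g := by
    intro c
    by_contra! hno
    set T : PGSubspace d F := Submodule.projectivization (LinearMap.ker (f + c • g)) with hT
    have hT1 : T.IsHyperplane := isHyperplane_ker fun h0 => by
      have := (LinearIndependent.pair_iff.1 h 1 c (by simpa using h0)).1
      simp at this
    have hHT : commonKer f g ≤ T := fun P hP => by
      induction P using Projectivization.ind with | h p hp =>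
      rw [mk_mem_commonKer] at hP
      rw [hT, Submodule.mk_mem_projectivization_iff]
      simp [hP.1, hP.2]
    -- If every line of `L` inside `T` lay in `H`, all points of `L` in `T` would lie in `H` and
    -- could not span `T`.
    have hle : T ≤ commonKer f g := by
      rw [← hgen T hT1, Projectivization.Subspace.span_le_subspace_iff]
      rintro P ⟨hP, hPT⟩
      obtain ⟨l, hlL, hPl⟩ := Set.mem_iUnion₂.1 hP
      by_cases hlT : l ≤ T
      · exact hno l hlL hlT hPl
      · exact (hL l hlL).mem_of_mem_of_not_le hHT (hmeet l hlL) hlT hPl hPT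
    have h2 := hasCodim_commonKer h
    rw [← le_antisymm hle hHT, HasCodim] at h2
    rw [IsHyperplane, HasCodim] at hT1
    omega
  choose l hlL hlT hlH using key
  -- Two distinct members of the pencil intersect exactly in `H`.
  have hinj : Function.Injective fun c => (⟨l c, hlL c⟩ : L) := by
    intro c c' hcc
    by_contra hne
    have hcc' : l c = l c' := congr_arg Subtype.val hcc
    refine hlH c fun P hP => ?_
    have h1 := hlT c hP
    have h2 := hlT c' (hcc' ▸ hP)
    induction P using Projectivization.ind with | h p hp =>
    rw [Submodule.mk_mem_projectivization_iff, LinearMap.mem_ker, LinearMap.add_apply,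
      LinearMap.smul_apply, smul_eq_mul] at h1 h2
    have hg : g p = 0 := by
      have : (c - c') * g p = 0 := by linear_combination h1 - h2
      exact (mul_eq_zero.1 this).resolve_left (sub_ne_zero.2 hne)
    exact (mk_mem_commonKer hp).2 ⟨by simpa [hg] using h1, hg⟩
  have := hfin.to_subtype
  exact not_injective_infinite_finite _ hinj

end PGSubspace

theorem PGSubspace.IsLine.exists_linearIndependent {d : ℕ} {F : Type*} [Field F]
    {l : PGSubspace d F} (hl : l.IsLine) : ∃ a b : Fin (d + 1) → F,
      LinearIndependent F ![a, b] ∧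
      Submodule.span F {a, b} ≤ Projectivization.Subspace.submodule l := by
  let B := Module.finBasisOfFinrankEq F (Projectivization.Subspace.submodule l) hl
  refine ⟨B 0, B 1, ?_, ?_⟩
  · have := B.linearIndependent.map' _ (Submodule.ker_subtype _)
    have h : ![(B 0 : Fin (d + 1) → F), B 1] =
        (Projectivization.Subspace.submodule l).subtype ∘ B := by
      ext i
      fin_cases i <;> rfl
    rw [h]
    exact this
  · rw [Submodule.span_le]
    rintro _ (rfl | rfl)
    exacts [(B 0).2, (B 1).2]

theorem mainTheorem2 {F : Type*} [Field F] [IsAlgClosed F] (d : ℕ)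
    (L : Set (PGSubspace d F)) (hL : ∀ l ∈ L, l.IsLine)
    (hcard : L.encard + 2 ≤ 2 * (d : ℕ∞)) :
    (∃ H : PGSubspace d F, H.HasCodim 2 ∧ ∀ l ∈ L, H.Meets l) ∧ ¬ IsLineGeneratorSet L := by
  have hfin : L.Finite := by
    rw [← Set.encard_ne_top_iff]
    intro h
    rw [h, top_add, top_le_iff] at hcard
    exact ENat.natCast_ne_top (2 * d) (by exact_mod_cast hcard)
  rw [← hfin.cast_ncard_eq] at hcard
  have hcard' : L.ncard + 2 ≤ 2 * d := by exact_mod_cast hcard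
  -- The additive form of the bound excludes `d = 0`.
  obtain ⟨k, rfl⟩ : ∃ k, d = k + 1 := ⟨d - 1, by omega⟩
  have := hfin.to_subtype
  choose a b hab hspan using fun l : L => (hL l l.2).exists_linearIndependent
  obtain ⟨f, g, hfg, hdet⟩ := exists_linearIndependent_det_eq_zero k
    (by rw [Nat.card_coe_set_eq]; omega) a b
  have hmeet : ∀ l ∈ L, (PGSubspace.commonKer f g).Meets l := fun l hl => by
    obtain ⟨v, hv, hv0, hf, hg⟩ :=
      PGSubspace.exists_mem_ne_zero_of_det_eq_zero (hab ⟨l, hl⟩) (hdet ⟨l, hl⟩)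
    exact ⟨Projectivization.mk F v hv0, (PGSubspace.mk_mem_commonKer hv0).2 ⟨hf, hg⟩,
      hspan ⟨l, hl⟩ hv hv0⟩
  exact ⟨⟨_, PGSubspace.hasCodim_commonKer hfg, hmeet⟩,
    PGSubspace.not_isLineGeneratorSet_of_meets hfin hL hfg hmeet⟩
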